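/- \textbf{Setting.} Let $d\ge 1$ and let $K=\{x\in\mathbb R^d : \langle a_i,x\rangle\le b_i,\ 1\le i\le M\}$ with $\|a_i\|=1$ be a convex polytope. Let $f$ be differentiable at the points of $K$, with $\|\nabla f(y)-\nabla f(z)\|\le L\|y-z\|$ for $y,z\in K$, and $m$-strongly convex on $K$, where $0<m\le L$; put $\kappa=L/m$ and $\mathcal H(x,v)=\tfrac12\|v\|^2+f(x)$. Let $\eta>0$ and let $\ell\ge 0$ be an integer. \emph{Reflected leapfrog step} from $(x,v)$, $x\in K$: put $\hat v=v-\tfrac{\eta}{2}\nabla f(x)$, $p=x$ and $q=x+\eta\hat v$. While $q\notin K$, let $n$ be the normal $a_i$ of the facet on which the segment from $p$ to $q$ first meets $\partial K$ (at ties, the smallest $i$; segments that start on a facet and point inwards do not hit it at their start, and facet hyperplanes parallel to the segment are ignored); replace $\hat v$ by $\hat v-2\langle\hat v,n\rangle n$ and, with $a=(q-p)-2\langle q-p,n\rangle n$, replace $(p,q)$ by $(q,q+a)$ (version 1) or by $(p,p+a)$ (version 2). When $q\in K$ is reached after $k\le\ell$ such reflections, the result is $(\tilde x',\tilde v')=(q,\hat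 v-\tfrac{\eta}{2}\nabla f(q))$. If no point of $K$ is reached in this way after at most $\ell$ reflections, the state is left unchanged, $(\tilde x',\tilde v')=(x,v)$. The proposal distribution $\mathcal P_x$ is the law of $\tilde x'$ when $v\sim\mathcal N(0,I_d)$. The transition distribution $\mathcal T_x$ is the law of the next position, which is $\tilde x'$ with probability $\min\{1,\exp(\mathcal H(x,v)-\mathcal H(\tilde x',\tilde v'))\}$ (given $v$) and $x$ otherwise. Let $\|\mu-\nu\|_{TV}=\sup_A|\mu(A)-\nu(A)|$ over Borel sets $A$. \textbf{Lemma.} For all $C_0>0$ and $\varepsilon_0<1$ there is a constant $B>0$, depending only on $C_0$ and $\varepsilon_0$, such that the following holds in the above setting, for both versions of the reflection, for all $d,M,\ell,K,f,L,m,\eta$. Let $0<\varepsilon\le\varepsilon_0$, $C\ge C_0$ and $c>0$ be such that $\tau=C/\sqrt c<1$, let $$\eta\le\frac{1}{\sqrt{Lc}\,d(\ell+1)\log(\kappa/\varepsilon)}\le\frac{e^{-(\ell+1)^2/6}}{(2\pi e)^{1/2}(\ell+1)},$$ and let $x\in\Omega=\{\omega\in K:\|\nabla f(\omega)\|\le\sqrt{Ld}\,C\log(\kappa/\varepsilon)\}$.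 Then $$\|\mathcal P_x-\mathcal T_x\|_{TV}\le 1-\tfrac{9}{10}\exp(-B\tau).$$ -/

import Mathlib

open MeasureTheory ProbabilityTheory

noncomputable section

namespace ReHMC

/-- The Euclidean space `ℝ^d` (with the `ℓ²` norm). -/
abbrev Vec (d : ℕ) := EuclideanSpace ℝ (Fin d)

/-- The description `A x ≤ b` of a convex polytope in `ℝ^d` by `M` inequalities, the rows of `A`
being the unit normal vectors of the facets. -/
structure Polytope (d M : ℕ) where
  /-- the rows of `A` -/
  normal : Fin M → Vec d
  /-- the entries of `b` -/
  offset : Fin M → ℝ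
  norm_normal : ∀ i, ‖normal i‖ = 1

namespace Polytope

variable {d M : ℕ}

/-- The set `K = {x | A x ≤ b}`. -/
def carrier (K : Polytope d M) : Set (Vec d) :=
  {x | ∀ i, inner ℝ (K.normal i) x ≤ K.offset i}

/-- The root `t` of `⟪aᵢ, p + t (q - p)⟫ = bᵢ`: the time at which the segment from `p` (time `0`)
to `q` (time `1`) meets the hyperplane of facet `i` (meaningful if `⟪aᵢ, q - p⟫ ≠ 0`). -/
def hitTime (K : Polytope d M) (p q : Vec d) (i : Fin M) : ℝ :=
  (K.offset i - inner ℝ (K.normal i) p) / inner ℝ (K.normal i) (q - p)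

/-- The segment from `p` to `q` meets `∂K` on facet `i`. A segment that starts on the facet and
points to its inner side is not regarded as hitting the facet at its starting point. -/
def Hits (K : Polytope d M) (p q : Vec d) (i : Fin M) : Prop :=
  inner ℝ (K.normal i) (q - p) ≠ 0 ∧
  0 ≤ K.hitTime p q i ∧ K.hitTime p q i ≤ 1 ∧
  p + K.hitTime p q i • (q - p) ∈ K.carrier ∧
  (0 < K.hitTime p q i ∨ 0 < inner ℝ (K.normal i) (q - p))

/-- Facet `i` is the one on which the segment from `p` to `q` meets `∂K` first. If several facets
are met at that time, then `i` is the first of them in the given order. -/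
def FirstHit (K : Polytope d M) (p q : Vec d) (i : Fin M) : Prop :=
  K.Hits p q i ∧
  (∀ j, K.Hits p q j → K.hitTime p q i ≤ K.hitTime p q j) ∧
  (∀ j, j < i → K.Hits p q j → K.hitTime p q i < K.hitTime p q j)

end Polytope

/-- Reflection of the vector `a` in the hyperplane orthogonal to the unit vector `n`. -/
def refl {d : ℕ} (n a : Vec d) : Vec d := a - (2 * inner ℝ a n) • n

/-- The two versions of the position update of a reflection. Let the last segment go from `p` to
`q`, where it was found that `q ∉ K`, and let `a` be the reflection of `q - p`. In the version
`fromEnd` the reflected segment is attached to the end point: the new position is `q + a`. In the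
version `fromStart` it replaces the old one: the new position is `p + a`. -/
inductive ReflectRule where
  | fromEnd
  | fromStart

/-- The point to which the reflected segment is attached. -/
def ReflectRule.base {d : ℕ} : ReflectRule → Vec d → Vec d → Vec d
  | fromEnd, _, q => q
  | fromStart, p, _ => p

open Classical in
/-- The loop of the reflections, at most `ℓ` of them. The last segment goes from `p` to `q`, and
`w` is the current velocity. If `q ∈ K`, the loop ends. If not, let `n` be the normal vector of the
facet on which the segment meets `∂K` first: the velocity becomes `w - 2 ⟪w, n⟫ n`, and the loop is
repeated with the segment that starts at the base point and has the direction `a - 2 ⟪a, n⟫ n`,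
where `a = q - p`. The value is `none` if no position in `K` is reached in this way by at most `ℓ`
reflections. -/
def reflect {d M : ℕ} (r : ReflectRule) (K : Polytope d M) :
    ℕ → Vec d → Vec d → Vec d → Option (Vec d × Vec d)
  | 0, _, q, w => if q ∈ K.carrier then some (q, w) else none
  | ℓ + 1, p, q, w =>
    if q ∈ K.carrier then some (q, w)
    else if h : ∃ i, K.FirstHit p q i then
      reflect r K ℓ (r.base p q) (r.base p q + refl (K.normal h.choose) (q - p))
        (refl (K.normal h.choose) w)
    else none

/-- One reflected leapfrog step of size `η` from the state `(x, v)`, with at most `ℓ` reflections: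
half a velocity step, the position step with its reflections, half a velocity step. If at most `ℓ`
reflections do not lead back into `K`, the state stays as it is. -/
def leapfrog {d M : ℕ} (r : ReflectRule) (K : Polytope d M) (f : Vec d → ℝ) (η : ℝ) (ℓ : ℕ)
    (x v : Vec d) : Vec d × Vec d :=
  match reflect r K ℓ x (x + η • (v - (η / 2) • gradient f x)) (v - (η / 2) • gradient f x) with
  | some (x', w) => (x', w - (η / 2) • gradient f x')
  | none => (x, v)

/-- The Hamiltonian `H(x, v) = ‖v‖² / 2 + f(x)`. -/
def hamiltonian {d : ℕ} (f : Vec d → ℝ) (z : Vec d × Vec d) : ℝ := ‖z.2‖ ^ 2 / 2 + f z.1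

/-- The bias `min {1, exp (H(x, v) - H(x', v'))}` of the Metropolis filter. -/
def acceptProb {d M : ℕ} (r : ReflectRule) (K : Polytope d M) (f : Vec d → ℝ) (η : ℝ) (ℓ : ℕ)
    (x v : Vec d) : ℝ :=
  min 1 (Real.exp (hamiltonian f (x, v) - hamiltonian f (leapfrog r K f η ℓ x v)))

/-- The proposal distribution `𝒫ₓ`: the law of the position `x'` that a reflected leapfrog step
reaches from `(x, v)`, where `v ∼ N(0, I_d)`. -/
def proposal {d M : ℕ} (r : ReflectRule) (K : Polytope d M) (f : Vec d → ℝ) (η : ℝ) (ℓ : ℕ)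
    (x : Vec d) : Measure (Vec d) :=
  (stdGaussian (Vec d)).map fun v => (leapfrog r K f η ℓ x v).1

open Classical in
/-- The transition distribution `𝒯ₓ`: the law of the next position of the sampler from `x`. Draw
`v ∼ N(0, I_d)` and, independently, `u` uniformly in `[0, 1]`; move to the proposed position if `u`
is at most the bias of the Metropolis filter, and stay at `x` otherwise. -/
def transition {d M : ℕ} (r : ReflectRule) (K : Polytope d M) (f : Vec d → ℝ) (η : ℝ) (ℓ : ℕ)
    (x : Vec d) : Measure (Vec d) :=
  ((stdGaussian (Vec d)).prod (volume.restrict (Set.Icc (0 : ℝ) 1))).map fun z =>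
    if z.2 ≤ acceptProb r K f η ℓ x z.1 then (leapfrog r K f η ℓ x z.1).1 else x

/-- The total variation distance `sup_A |μ(A) - ν(A)|` over all measurable sets `A` (for
probability measures). -/
def tvDist {X : Type*} [MeasurableSpace X] (μ ν : Measure X) : ℝ :=
  ⨆ A : {A : Set X // MeasurableSet A}, |μ.real A - ν.real A|

/-- The set `Ω` of the points of `K` with `‖∇f‖ ≤ √(L d) C log (κ / ε)`, where `κ = L / m`. -/
def Omega {d M : ℕ} (K : Polytope d M) (f : Vec d → ℝ) (L m C ε : ℝ) : Set (Vec d) :=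
  {x | x ∈ K.carrier ∧ ‖gradient f x‖ ≤ √(L * d) * C * Real.log (L / m / ε)}

end ReHMC

end

/-!
The proposal and the transition are images of the same Gaussian velocity `v`, and they differ only
when the Metropolis filter rejects. Hence their total variation distance is at most the probability
of rejection (`tvDist_proposal_transition_le`), and it is enough to bound the acceptance
probability from below by `exp (-B τ)` on a set of velocities of Gaussian measure at least `9/10`.

That set is the ball `‖v‖ ≤ 4 √d`, by Markov's inequality and `E ‖v‖² = d`
(`stdGaussian_norm_le_ge`). On it the energy error is estimated termwise. Reflections preserve the
norm of the velocity and the length of the segment, so after at most `ℓ` of them the position has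
moved by at most `R = 5 (ℓ + 1) η √d`. The set `K` is convex and `∇f` is `L`-Lipschitz on it, so
`‖∇f‖ ≤ G = ‖∇f x‖ + L R` on the segment from `x` to the new position, and the mean value inequality
bounds the change of `f` by `R G`. The change of the kinetic energy comes from the two half steps of
the velocity and is at most `R G + (R G)²` (`hamiltonian_leapfrog_le`). Finally the bound on `η`
and `x ∈ Ω` give `R ‖∇f x‖ ≤ 5 τ` and `L R² ≤ 25 τ / (C₀ log (1 / ε₀))²`, whence `R G = O(τ)`
(`scale_bounds`). The number of reflections enters only through the factor `ℓ + 1` in `R`, which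
the step size compensates.

The laws are defined by `Measure.map`, so the leapfrog step must be shown to be measurable in `v`
(`measurable_reflect_elim`): the facet hit first depends measurably on the segment.
-/

namespace ReHMC

variable {d M : ℕ}

/-! ### Geometry of the reflected step -/

lemma norm_refl {n : Vec d} (hn : ‖n‖ = 1) (a : Vec d) : ‖refl n a‖ = ‖a‖ := by
  have h : ‖refl n a‖ ^ 2 = ‖a‖ ^ 2 := by
    rw [refl, norm_sub_sq_real, inner_smul_right, norm_smul, hn, Real.norm_eq_abs, mul_one, sq_abs]
    ring
  exact (sq_eq_sq₀ (norm_nonneg _) (norm_nonneg _)).1 h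

/-- A successful loop ends in `K`, preserves the speed, and ends at a distance from the start of
the segment of at most `ℓ + 1` times the length of the segment. -/
lemma reflect_eq_some (r : ReflectRule) (K : Polytope d M) (ℓ : ℕ) (p q w x' w' : Vec d)
    (h : reflect r K ℓ p q w = some (x', w')) :
    x' ∈ K.carrier ∧ ‖w'‖ = ‖w‖ ∧ ‖x' - p‖ ≤ (ℓ + 1) * ‖q - p‖ := by
  induction ℓ generalizing p q w with
  | zero =>
    rw [reflect] at h
    split_ifs at h with hq
    obtain ⟨rfl, rfl⟩ := Prod.mk.inj (Option.some.inj h)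
    simp [hq]
  | succ ℓ ih =>
    rw [reflect] at h
    split_ifs at h with hq hi
    · obtain ⟨rfl, rfl⟩ := Prod.mk.inj (Option.some.inj h)
      refine ⟨hq, rfl, ?_⟩
      push_cast
      nlinarith [norm_nonneg (q - p), mul_nonneg (Nat.cast_nonneg (α := ℝ) ℓ) (norm_nonneg (q - p))]
    · obtain ⟨h1, h2, h3⟩ := ih _ _ _ h
      rw [norm_refl (K.norm_normal _)] at h2
      rw [add_sub_cancel_left, norm_refl (K.norm_normal _)] at h3
      refine ⟨h1, h2, ?_⟩
      have hb : ‖r.base p q - p‖ ≤ ‖q - p‖ := by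
        cases r <;> simp [ReflectRule.base]
      have := norm_sub_le_norm_sub_add_norm_sub x' (r.base p q) p
      push_cast
      linarith

lemma convex_carrier (K : Polytope d M) : Convex ℝ K.carrier := by
  have : K.carrier = ⋂ i, {x | inner ℝ (K.normal i) x ≤ K.offset i} := by
    ext x; simp [Polytope.carrier]
  rw [this]
  exact convex_iInter fun i =>
    convex_halfSpace_le (innerSL ℝ (K.normal i)).toLinearMap.isLinear _

lemma isClosed_carrier (K : Polytope d M) : IsClosed K.carrier := by
  have : K.carrier = ⋂ i, {x | inner ℝ (K.normal i) x ≤ K.offset i} := by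
    ext x; simp [Polytope.carrier]
  rw [this]
  exact isClosed_iInter fun i => isClosed_le (by fun_prop) continuous_const

/-! ### Measurability -/

lemma measurable_of_countable_cover {α β ι : Type*} [MeasurableSpace α] [MeasurableSpace β]
    [Countable ι] {S : ι → Set α} (hS : ∀ i, MeasurableSet (S i)) (hcov : ∀ a, ∃ i, a ∈ S i)
    {F : α → β} {G : ι → α → β} (hG : ∀ i, Measurable (G i)) (h : ∀ i, ∀ a ∈ S i, F a = G i a) :
    Measurable F := by
  intro s hs
  have : F ⁻¹' s = ⋃ i, S i ∩ G i ⁻¹' s := by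
    ext a
    simp only [Set.mem_preimage, Set.mem_iUnion, Set.mem_inter_iff]
    constructor
    · intro ha
      obtain ⟨i, hi⟩ := hcov a
      exact ⟨i, hi, h i a hi ▸ ha⟩
    · rintro ⟨i, hi, ha⟩
      exact (h i a hi).symm ▸ ha
  rw [this]
  exact .iUnion fun i => (hS i).inter (hG i hs)

lemma Polytope.FirstHit.unique {K : Polytope d M} {p q : Vec d} {i j : Fin M}
    (hi : K.FirstHit p q i) (hj : K.FirstHit p q j) : i = j := by
  rcases lt_trichotomy i j with h | h | h
  · exact absurd (hj.2.2 i h hi.1) (hi.2.1 j hj.1).not_gt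
  · exact h
  · exact absurd (hi.2.2 j h hj.1) (hj.2.1 i hi.1).not_gt

section

variable {α : Type*} [MeasurableSpace α]

lemma measurable_refl (n : Vec d) : Measurable (refl n) := by
  unfold refl
  fun_prop

lemma measurable_hitTime (K : Polytope d M) {p q : α → Vec d} (hp : Measurable p)
    (hq : Measurable q) (i : Fin M) : Measurable fun a => K.hitTime (p a) (q a) i := by
  unfold Polytope.hitTime
  fun_prop

lemma measurableSet_hits (K : Polytope d M) {p q : α → Vec d} (hp : Measurable p)
    (hq : Measurable q) (i : Fin M) : MeasurableSet {a | K.Hits (p a) (q a) i} := by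
  have ht := measurable_hitTime K hp hq i
  have hn : Measurable fun a => inner ℝ (K.normal i) (q a - p a) := by fun_prop
  have hK : MeasurableSet
      {a | p a + K.hitTime (p a) (q a) i • (q a - p a) ∈ K.carrier} :=
    (hp.add (ht.smul (hq.sub hp))) (isClosed_carrier K).measurableSet
  unfold Polytope.Hits
  exact (measurableSet_eq_fun hn measurable_const).compl.inter
    ((measurableSet_le measurable_const ht).inter
      ((measurableSet_le ht measurable_const).inter
        (hK.inter ((measurableSet_lt measurable_const ht).union
          (measurableSet_lt measurable_const hn)))))

lemma measurableSet_firstHit (K : Polytope d M) {p q : α → Vec d} (hp : Measurable p)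
    (hq : Measurable q) (i : Fin M) : MeasurableSet {a | K.FirstHit (p a) (q a) i} := by
  have ht := measurable_hitTime K hp hq
  have hh := measurableSet_hits K hp hq
  unfold Polytope.FirstHit
  refine (hh i).inter (MeasurableSet.inter ?_ ?_)
  · exact measurableSet_setOfPred.2 (Measurable.forall fun j =>
      (measurableSet_setOfPred.1 (hh j)).imp
        (measurableSet_setOfPred.1 (measurableSet_le (ht i) (ht j))))
  · exact measurableSet_setOfPred.2 (Measurable.forall fun j => measurable_const.imp
      ((measurableSet_setOfPred.1 (hh j)).imp
        (measurableSet_setOfPred.1 (measurableSet_lt (ht i) (ht j)))))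

/-- Measurability of the loop, stated through an eliminator so that no measurable structure on
`Option` is needed. -/
lemma measurable_reflect_elim {β : Type*} [MeasurableSpace β] (r : ReflectRule) (K : Polytope d M)
    (ℓ : ℕ) {p q w : α → Vec d} (hp : Measurable p) (hq : Measurable q) (hw : Measurable w)
    {D : α → β} (hD : Measurable D) {Φ : Vec d × Vec d → β} (hΦ : Measurable Φ) :
    Measurable fun a => (reflect r K ℓ (p a) (q a) (w a)).elim (D a) Φ := by
  have hK := (isClosed_carrier K).measurableSet
  induction ℓ generalizing p q w with
  | zero =>
    classical
    have : (fun a => (reflect r K 0 (p a) (q a) (w a)).elim (D a) Φ) =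
        (q ⁻¹' K.carrier).piecewise (fun a => Φ (q a, w a)) D := by
      ext a
      by_cases h : q a ∈ K.carrier <;> simp [reflect, Set.piecewise, h]
    rw [this]
    exact (hΦ.comp (hq.prodMk hw)).piecewise (hq hK) hD
  | succ ℓ ih =>
    have hb : Measurable fun a => r.base (p a) (q a) := by
      cases r
      · exact hq
      · exact hp
    have hF := measurableSet_firstHit K hp hq
    -- The pieces: the segment ends in `K`, facet `i` is hit first, or no facet is hit.
    let S : Option (Option (Fin M)) → Set α
      | none => {a | q a ∈ K.carrier}
      | some (some i) => {a | q a ∉ K.carrier} ∩ {a | K.FirstHit (p a) (q a) i}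
      | some none => {a | q a ∉ K.carrier} ∩ {a | ∃ i, K.FirstHit (p a) (q a) i}ᶜ
    let G : Option (Option (Fin M)) → α → β
      | none => fun a => Φ (q a, w a)
      | some (some i) => fun a => (reflect r K ℓ (r.base (p a) (q a))
          (r.base (p a) (q a) + refl (K.normal i) (q a - p a)) (refl (K.normal i) (w a))).elim
            (D a) Φ
      | some none => D
    refine measurable_of_countable_cover (S := S) (G := G) ?_ ?_ ?_ ?_
    · rintro (_ | _ | i)
      · exact hq hK
      · exact (hq hK).compl.inter (measurableSet_setOfPred.2
          (Measurable.exists fun i => measurableSet_setOfPred.1 (hF i))).compl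
      · exact (hq hK).compl.inter (hF i)
    · intro a
      by_cases h : q a ∈ K.carrier
      · exact ⟨none, h⟩
      · by_cases h' : ∃ i, K.FirstHit (p a) (q a) i
        · obtain ⟨i, hi⟩ := h'
          exact ⟨some (some i), h, hi⟩
        · exact ⟨some none, h, h'⟩
    · rintro (_ | _ | i)
      · exact hΦ.comp (hq.prodMk hw)
      · exact hD
      · exact ih hb (hb.add ((measurable_refl _).comp (hq.sub hp))) ((measurable_refl _).comp hw)
    · rintro (_ | _ | i) a ha
      · have ha : q a ∈ K.carrier := ha
        simp [reflect, G, ha]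
      · have h1 : q a ∉ K.carrier := ha.1
        have h2 : ¬ ∃ i, K.FirstHit (p a) (q a) i := ha.2
        simp only [reflect, G, if_neg h1, dif_neg h2, Option.elim]
      · have h1 : q a ∉ K.carrier := ha.1
        have h2 : ∃ i, K.FirstHit (p a) (q a) i := ⟨i, ha.2⟩
        have h3 : h2.choose = i := h2.choose_spec.unique ha.2
        simp only [reflect, G, if_neg h1, dif_pos h2, h3]

end

lemma measurable_gradient (f : Vec d → ℝ) : Measurable (gradient f) :=
  (InnerProductSpace.toDual ℝ (Vec d)).symm.continuous.measurable.comp (measurable_fderiv ℝ f)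

lemma measurable_leapfrog (r : ReflectRule) (K : Polytope d M) (f : Vec d → ℝ) (η : ℝ) (ℓ : ℕ)
    (x : Vec d) : Measurable (leapfrog r K f η ℓ x) := by
  have hg := measurable_gradient f
  have h := measurable_reflect_elim (α := Vec d) r K ℓ (p := fun _ => x)
    (q := fun v => x + η • (v - (η / 2) • gradient f x))
    (w := fun v => v - (η / 2) • gradient f x) (by fun_prop) (by fun_prop) (by fun_prop)
    (D := fun v => (x, v)) (by fun_prop)
    (Φ := fun z => (z.1, z.2 - (η / 2) • gradient f z.1)) (by fun_prop)
  convert h using 2 with v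
  unfold leapfrog
  cases reflect r K ℓ x (x + η • (v - (η / 2) • gradient f x)) (v - (η / 2) • gradient f x) <;> rfl

lemma leapfrog_fst_mem (r : ReflectRule) (K : Polytope d M) (f : Vec d → ℝ) (η : ℝ) (ℓ : ℕ)
    {x : Vec d} (hx : x ∈ K.carrier) (v : Vec d) : (leapfrog r K f η ℓ x v).1 ∈ K.carrier := by
  unfold leapfrog
  split
  · next x' w h => exact (reflect_eq_some _ _ _ _ _ _ _ _ h).1
  · exact hx

lemma measurable_acceptProb (r : ReflectRule) (K : Polytope d M) {f : Vec d → ℝ}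
    (hf : ContinuousOn f K.carrier) (η : ℝ) (ℓ : ℕ) {x : Vec d} (hx : x ∈ K.carrier) :
    Measurable (acceptProb r K f η ℓ x) := by
  classical
  -- Off `K` the function `f` need not be measurable; the sampler only evaluates it on `K`.
  have hm : Measurable (K.carrier.piecewise f 0) :=
    hf.measurable_piecewise continuousOn_const (isClosed_carrier K).measurableSet
  have hl := measurable_leapfrog r K f η ℓ x
  have he : acceptProb r K f η ℓ x = fun v => min 1 (Real.exp (‖v‖ ^ 2 / 2 + f x -
      (‖(leapfrog r K f η ℓ x v).2‖ ^ 2 / 2 +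
        K.carrier.piecewise f 0 (leapfrog r K f η ℓ x v).1))) := by
    ext v
    rw [Set.piecewise_eq_of_mem _ _ _ (leapfrog_fst_mem r K f η ℓ hx v)]
    rfl
  rw [he]
  have h2 := hm.comp hl.fst
  simp only [Function.comp_def] at h2
  fun_prop

/-! ### Total variation distance and rejection -/

/-- Two images of the same probability measure are at most as far apart as the measure of the set
on which the two maps differ. -/
lemma tvDist_map_le {α X : Type*} [MeasurableSpace α] [MeasurableSpace X] {μ : Measure α}
    [IsProbabilityMeasure μ] {F G : α → X} (hF : Measurable F) (hG : Measurable G) {S : Set α}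
    (hS : MeasurableSet S) (h : ∀ a ∈ S, F a = G a) :
    tvDist (μ.map F) (μ.map G) ≤ 1 - μ.real S := by
  have key : ∀ (F G : α → X), (∀ a ∈ S, F a = G a) → ∀ A : Set X,
      μ.real (F ⁻¹' A) ≤ μ.real (G ⁻¹' A) + (1 - μ.real S) := by
    intro F G h A
    rw [← probReal_compl_eq_one_sub hS]
    refine (measureReal_mono ?_).trans (measureReal_union_le _ _)
    intro a ha
    by_cases haS : a ∈ S
    · exact Or.inl (by simpa [← h a haS] using ha)
    · exact Or.inr haS
  have : Nonempty {A : Set X // MeasurableSet A} := ⟨⟨∅, .empty⟩⟩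
  refine ciSup_le fun A => ?_
  rw [map_measureReal_apply hF A.2, map_measureReal_apply hG A.2, abs_le]
  have h1 := key F G h A
  have h2 := key G F (fun a ha => (h a ha).symm) A
  constructor <;> linarith

instance : IsProbabilityMeasure (volume.restrict (Set.Icc (0 : ℝ) 1)) :=
  ⟨by simp⟩

/-- If the filter accepts with probability at least `s` on a set `G` of velocities, then proposal
and transition are at distance at most `1 - γ(G) s`. -/
lemma tvDist_proposal_transition_le (r : ReflectRule) (K : Polytope d M) {f : Vec d → ℝ}
    (hf : ContinuousOn f K.carrier) (η : ℝ) (ℓ : ℕ) {x : Vec d} (hx : x ∈ K.carrier)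
    {G : Set (Vec d)} (hG : MeasurableSet G) {s : ℝ} (hs0 : 0 ≤ s) (hs1 : s ≤ 1)
    (h : ∀ v ∈ G, s ≤ acceptProb r K f η ℓ x v) :
    tvDist (proposal r K f η ℓ x) (transition r K f η ℓ x) ≤
      1 - (stdGaussian (Vec d)).real G * s := by
  classical
  have hl := (measurable_leapfrog r K f η ℓ x).fst
  have ha := measurable_acceptProb r K hf η ℓ hx
  have hp : proposal r K f η ℓ x =
      ((stdGaussian (Vec d)).prod (volume.restrict (Set.Icc (0 : ℝ) 1))).map
        fun z => (leapfrog r K f η ℓ x z.1).1 := by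
    have h1 : (stdGaussian (Vec d)) =
        ((stdGaussian (Vec d)).prod (volume.restrict (Set.Icc (0 : ℝ) 1))).map Prod.fst := by
      rw [Measure.map_fst_prod]; simp
    conv_lhs => rw [proposal, h1]
    rw [Measure.map_map hl measurable_fst]
    rfl
  have hv : ((stdGaussian (Vec d)).prod (volume.restrict (Set.Icc (0 : ℝ) 1))).real
      (G ×ˢ Set.Icc 0 s) = (stdGaussian (Vec d)).real G * s := by
    rw [measureReal_prod_prod]
    congr 1
    rw [measureReal_restrict_apply measurableSet_Icc,
      Set.inter_eq_left.2 (Set.Icc_subset_Icc_right hs1), Real.volume_real_Icc_of_le hs0, sub_zero]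
  rw [hp, transition, ← hv]
  refine tvDist_map_le (hl.comp measurable_fst) ?_ (hG.prod measurableSet_Icc) ?_
  · exact Measurable.ite (measurableSet_le measurable_snd (ha.comp measurable_fst))
      (hl.comp measurable_fst) measurable_const
  · rintro ⟨v, u⟩ ⟨hv, hu⟩
    exact (if_pos (hu.2.trans (h v hv))).symm

/-! ### Gaussian velocities -/

lemma integral_norm_sq_stdGaussian :
    ∫ v, ‖v‖ ^ 2 ∂(stdGaussian (Vec d)) = d := by
  have h1 : ∀ i : Fin d, ∫ v : Vec d, v i ^ 2 ∂(stdGaussian (Vec d)) = 1 := by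
    intro i
    have h := variance_dual_stdGaussian (EuclideanSpace.proj (𝕜 := ℝ) i : Vec d →L[ℝ] ℝ)
    have hn := (EuclideanSpace.basisFun (Fin d) ℝ).norm_dual
      (EuclideanSpace.proj (𝕜 := ℝ) i : Vec d →L[ℝ] ℝ)
    rw [variance_of_integral_eq_zero (by fun_prop) (integral_strongDual_stdGaussian _), hn] at h
    simpa [Pi.single_apply] using h
  simp_rw [EuclideanSpace.real_norm_sq_eq]
  rw [integral_finsetSum]
  · simp [h1]
  · intro i _
    have : MemLp (fun v : Vec d => v i) 2 (stdGaussian (Vec d)) :=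
      (IsGaussian.memLp_two_id (μ := stdGaussian (Vec d))).continuousLinearMap_comp
        (EuclideanSpace.proj (𝕜 := ℝ) i : Vec d →L[ℝ] ℝ)
    exact this.integrable_sq

lemma stdGaussian_norm_le_ge (hd : 1 ≤ d) :
    9 / 10 ≤ (stdGaussian (Vec d)).real {v | ‖v‖ ≤ 4 * √d} := by
  have hd' : (1 : ℝ) ≤ d := by exact_mod_cast hd
  have hi : Integrable (fun v : Vec d => ‖v‖ ^ 2) (stdGaussian (Vec d)) :=
    (IsGaussian.memLp_two_id (μ := stdGaussian (Vec d))).norm.integrable_sq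
  have hm := mul_meas_ge_le_integral_of_nonneg (.of_forall fun v => sq_nonneg ‖v‖) hi (16 * d)
  rw [integral_norm_sq_stdGaussian] at hm
  have hS : MeasurableSet {v : Vec d | ‖v‖ ≤ 4 * √d} :=
    measurableSet_le measurable_norm measurable_const
  have hc : (stdGaussian (Vec d)).real {v | ‖v‖ ≤ 4 * √d}ᶜ ≤
      (stdGaussian (Vec d)).real {v | 16 * (d : ℝ) ≤ ‖v‖ ^ 2} := by
    refine measureReal_mono fun v hv => ?_
    have hv : 4 * √d < ‖v‖ := not_le.1 hv
    have hq : √(d : ℝ) ^ 2 = d := Real.sq_sqrt (by positivity)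
    have : (4 * √(d : ℝ)) ^ 2 ≤ ‖v‖ ^ 2 := by gcongr
    rw [mul_pow, hq] at this
    change 16 * (d : ℝ) ≤ ‖v‖ ^ 2
    linarith
  rw [probReal_compl_eq_one_sub hS] at hc
  have : (stdGaussian (Vec d)).real {v | 16 * (d : ℝ) ≤ ‖v‖ ^ 2} ≤ 1 / 16 := by
    rw [le_div_iff₀ (by norm_num)]
    exact le_of_mul_le_mul_left (a := (d : ℝ)) (by linarith) (by linarith)
  linarith

/-! ### The energy error -/

lemma norm_gradient_eq (f : Vec d → ℝ) (x : Vec d) : ‖fderiv ℝ f x‖ = ‖gradient f x‖ :=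
  ((InnerProductSpace.toDual ℝ (Vec d)).symm.norm_map _).symm

/-- Let the half step velocity have norm at most `V`, let `R` bound the distance moved, and let `G`
bound the gradient within distance `R`. Then the energy grows by at most `2 R G + (R G)²`. -/
lemma hamiltonian_leapfrog_le (r : ReflectRule) (K : Polytope d M) (f : Vec d → ℝ) (η L : ℝ)
    (ℓ : ℕ) {x v : Vec d} (hx : x ∈ K.carrier) (hη : 0 ≤ η) (hL : 0 ≤ L)
    (hdiff : ∀ y ∈ K.carrier, DifferentiableAt ℝ f y)
    (hlip : ∀ y ∈ K.carrier, ∀ z ∈ K.carrier, ‖gradient f y - gradient f z‖ ≤ L * ‖y - z‖)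
    {V R G : ℝ} (hV1 : 1 ≤ V) (hV : ‖v - (η / 2) • gradient f x‖ ≤ V)
    (hR : (ℓ + 1) * (η * V) ≤ R) (hG : ‖gradient f x‖ + L * R ≤ G) :
    hamiltonian f (leapfrog r K f η ℓ x v) ≤
      hamiltonian f (x, v) + (2 * (R * G) + (R * G) ^ 2) := by
  have hηV : η * V ≤ R := by
    refine le_trans ?_ hR
    have : 0 ≤ (ℓ : ℝ) * (η * V) := by positivity
    linarith
  have hηR : η ≤ R := le_trans (by nlinarith) hηV
  have hR0 : 0 ≤ R := hη.trans hηR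
  have hG0 : 0 ≤ G := le_trans (by positivity) hG
  unfold leapfrog
  split
  · next x' w h =>
    obtain ⟨hx', hw, hdist⟩ := reflect_eq_some _ _ _ _ _ _ _ _ h
    set u := v - (η / 2) • gradient f x with hu
    have hdist' : ‖x' - x‖ ≤ R := by
      refine hdist.trans (le_trans ?_ hR)
      rw [add_sub_cancel_left, norm_smul, Real.norm_of_nonneg hη]
      gcongr
    have hgrad : ∀ y ∈ K.carrier, ‖y - x‖ ≤ R → ‖gradient f y‖ ≤ G := by
      intro y hy hyx
      have h1 := hlip y hy x hx
      have h2 := norm_le_norm_add_norm_sub' (gradient f y) (gradient f x)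
      have h3 : L * ‖y - x‖ ≤ L * R := by gcongr
      linarith
    have hgx := hgrad x hx (by simpa using hR0)
    have hgx' := hgrad x' hx' hdist'
    have hfd : f x' - f x ≤ R * G := by
      have hseg : segment ℝ x x' ⊆ K.carrier := (convex_carrier K).segment_subset hx hx'
      have := (convex_segment (𝕜 := ℝ) x x').norm_image_sub_le_of_norm_fderiv_le (𝕜 := ℝ) (f := f)
        (C := G)
        (fun y hy => hdiff y (hseg hy))
        (fun y hy => by
          rw [norm_gradient_eq]
          exact hgrad y (hseg hy) ((norm_sub_le_of_mem_segment hy).trans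
            (by simpa [norm_sub_rev] using hdist')))
        (left_mem_segment ℝ x x') (right_mem_segment ℝ x x')
      calc f x' - f x ≤ ‖f x' - f x‖ := Real.le_norm_self _
        _ ≤ G * ‖x' - x‖ := this
        _ ≤ G * R := by gcongr
        _ = R * G := mul_comm _ _
    have hv : v = u + (η / 2) • gradient f x := by rw [hu]; abel
    have hi1 : |inner ℝ u (gradient f x)| ≤ V * G :=
      (abs_real_inner_le_norm _ _).trans (by gcongr)
    have hi2 : |inner ℝ w (gradient f x')| ≤ V * G :=
      (abs_real_inner_le_norm _ _).trans (by rw [hw]; gcongr)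
    have hk1 : ‖v‖ ^ 2 ≥ ‖u‖ ^ 2 - η * (V * G) := by
      rw [hv, norm_add_sq_real, inner_smul_right]
      have := mul_le_mul_of_nonneg_left (abs_le.1 hi1).1 hη
      have := sq_nonneg ‖(η / 2) • gradient f x‖
      linarith
    have hk2 : ‖w - (η / 2) • gradient f x'‖ ^ 2 ≤ ‖u‖ ^ 2 + η * (V * G) + (R * G) ^ 2 := by
      rw [norm_sub_sq_real, inner_smul_right, hw]
      have h1 := mul_le_mul_of_nonneg_left (abs_le.1 hi2).1 hη
      have h2 : ‖(η / 2) • gradient f x'‖ ≤ R * G := by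
        rw [norm_smul, Real.norm_of_nonneg (by positivity)]
        gcongr
        linarith
      have h3 : ‖(η / 2) • gradient f x'‖ ^ 2 ≤ (R * G) ^ 2 := by gcongr
      linarith
    have hVG : η * (V * G) ≤ R * G := by
      rw [← mul_assoc]; gcongr
    simp only [hamiltonian]
    nlinarith [sq_nonneg (R * G)]
  · have : 0 ≤ R * G := mul_nonneg hR0 hG0
    have := sq_nonneg (R * G)
    linarith

/-- The arithmetic of the step size: with `D = √d`, `N = ℓ + 1`, `l = log (κ / ε)` and
`R = N η (5 D)`, the product `R (g + L R)` is `O(τ)`. -/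
lemma scale_bounds {C₀ l₀ L c C η D N l g : ℝ} (hC₀ : 0 < C₀) (hl₀ : 0 < l₀) (hL : 0 < L)
    (hc : 0 < c) (hC : C₀ ≤ C) (hl : l₀ ≤ l) (hD : 1 ≤ D) (hN : 1 ≤ N) (hη : 0 < η)
    (hτ : C / √c < 1) (hηle : η ≤ 1 / (√(L * c) * D ^ 2 * N * l))
    (hg0 : 0 ≤ g) (hg : g ≤ √L * D * C * l) :
    η * g ≤ 1 ∧
      N * (η * (5 * D)) * (g + L * (N * (η * (5 * D)))) ≤
        (5 + 25 / (C₀ * l₀) ^ 2) * (C / √c) := by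
  have hsL : 0 < √L := Real.sqrt_pos.2 hL
  have hsc : 0 < √c := Real.sqrt_pos.2 hc
  have hC' : 0 < C := hC₀.trans_le hC
  have hl' : 0 < l := hl₀.trans_le hl
  have hLL : √L ^ 2 = L := Real.sq_sqrt hL.le
  have hD0 : 0 < D := one_pos.trans_le hD
  have hN0 : 0 < N := one_pos.trans_le hN
  set τ := C / √c with hτd
  have hτ0 : 0 < τ := by positivity
  have he : η * √L * N * D ^ 2 * l ≤ 1 / √c := by
    rw [Real.sqrt_mul hL.le, le_div_iff₀ (by positivity)] at hηle
    rw [le_div_iff₀ hsc]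
    linarith
  have h1 : N * (η * D) * g ≤ τ := by
    calc N * (η * D) * g ≤ N * (η * D) * (√L * D * C * l) := by gcongr
      _ = C * (η * √L * N * D ^ 2 * l) := by ring
      _ ≤ C * (1 / √c) := by gcongr
      _ = τ := by rw [hτd]; ring
  have h2 : η * √L * N * D ≤ τ / (C₀ * l₀) := by
    rw [le_div_iff₀ (by positivity)]
    calc η * √L * N * D * (C₀ * l₀) ≤ η * √L * N * (D * D) * (C * l) := by
          gcongr
          nlinarith
      _ = C * (η * √L * N * D ^ 2 * l) := by ring
      _ ≤ C * (1 / √c) := by gcongr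
      _ = τ := by rw [hτd]; ring
  have h3 : (η * √L * N * D) ^ 2 ≤ τ / (C₀ * l₀) ^ 2 := by
    calc (η * √L * N * D) ^ 2 ≤ (τ / (C₀ * l₀)) ^ 2 := by gcongr
      _ = τ ^ 2 / (C₀ * l₀) ^ 2 := div_pow _ _ _
      _ ≤ τ / (C₀ * l₀) ^ 2 := by
        gcongr
        nlinarith
  constructor
  · have : η * g ≤ N * (η * D) * g := by
      have : η ≤ N * (η * D) := by
        have : 1 ≤ N * D := by nlinarith
        nlinarith
      gcongr
    linarith
  · calc N * (η * (5 * D)) * (g + L * (N * (η * (5 * D))))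
        = 5 * (N * (η * D) * g) + 25 * (η * √L * N * D) ^ 2 := by
          rw [mul_pow, mul_pow, mul_pow, hLL]; ring
      _ ≤ 5 * τ + 25 * (τ / (C₀ * l₀) ^ 2) := by gcongr
      _ = (5 + 25 / (C₀ * l₀) ^ 2) * τ := by ring

end ReHMC

/-- The constant `B` of `O(τ)` depends only on a positive lower bound `C₀` for `C` and on an upper
bound `ε₀ < 1` for the accuracy `ε`. -/
theorem mainTheorem3 (C₀ ε₀ : ℝ) (hC₀ : 0 < C₀) (hε₀ : ε₀ < 1) :
    ∃ B : ℝ, 0 < B ∧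
      ∀ (d M ℓ : ℕ) (r : ReHMC.ReflectRule) (K : ReHMC.Polytope d M)
        (f : ReHMC.Vec d → ℝ) (L m ε c C η : ℝ) (x : ReHMC.Vec d),
        1 ≤ d → 0 < m → m ≤ L →
        (∀ y ∈ K.carrier, DifferentiableAt ℝ f y) →
        (∀ y ∈ K.carrier, ∀ z ∈ K.carrier, ‖gradient f y - gradient f z‖ ≤ L * ‖y - z‖) →
        StrongConvexOn K.carrier m f →
        0 < ε → ε ≤ ε₀ → C₀ ≤ C → 0 < c → C / √c < 1 →
        0 < η →
        η ≤ 1 / (√(L * c) * d * (ℓ + 1) * Real.log (L / m / ε)) →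
        1 / (√(L * c) * d * (ℓ + 1) * Real.log (L / m / ε)) ≤
          Real.exp (-((ℓ : ℝ) + 1) ^ 2 / 6) /
            ((2 * Real.pi * Real.exp 1) ^ (1 / 2 : ℝ) * (ℓ + 1)) →
        x ∈ ReHMC.Omega K f L m C ε →
        ReHMC.tvDist (ReHMC.proposal r K f η ℓ x) (ReHMC.transition r K f η ℓ x) ≤
          1 - 9 / 10 * Real.exp (-(B * (C / √c))) := by
  -- For `ε₀ ≤ 0` no `ε` is admissible, and the value of the logarithm is irrelevant.
  set b : ℝ := 5 + 25 / (C₀ * -Real.log ε₀) ^ 2 with hb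
  have hb0 : 0 < b := by positivity
  refine ⟨2 * b + b ^ 2, by positivity, ?_⟩
  intro d M ℓ r K f L m ε c C η x hd hm hmL hdiff hlip _ hε hεε hC hc hτ hη hηle _ hx
  have hL : 0 < L := hm.trans_le hmL
  have hε0 : 0 < ε₀ := hε.trans_le hεε
  have hl₀ : 0 < -Real.log ε₀ := by linarith [Real.log_neg hε0 hε₀]
  have hl : -Real.log ε₀ ≤ Real.log (L / m / ε) := by
    rw [← Real.log_inv]
    apply Real.log_le_log (by positivity)
    rw [← one_div]
    have : 1 ≤ L / m := (one_le_div hm).2 hmL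
    gcongr
  have hd' : (1 : ℝ) ≤ d := by exact_mod_cast hd
  have hD : 1 ≤ √(d : ℝ) := Real.one_le_sqrt.2 hd'
  have hτ0 : 0 < C / √c := div_pos (hC₀.trans_le hC) (Real.sqrt_pos.2 hc)
  obtain ⟨h1, h2⟩ := ReHMC.scale_bounds (N := (ℓ : ℝ) + 1) (D := √(d : ℝ)) hC₀ hl₀ hL hc hC hl hD
    (by linarith [Nat.cast_nonneg (α := ℝ) ℓ]) hη hτ
    (by rwa [Real.sq_sqrt (by linarith)]) (norm_nonneg (gradient f x))
    (by rw [← Real.sqrt_mul hL.le]; exact hx.2)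
  have hcont : ContinuousOn f K.carrier :=
    fun y hy => (hdiff y hy).continuousAt.continuousWithinAt
  have hball : MeasurableSet {v : ReHMC.Vec d | ‖v‖ ≤ 4 * √d} :=
    measurableSet_le measurable_norm measurable_const
  refine (ReHMC.tvDist_proposal_transition_le r K hcont η ℓ hx.1 hball (Real.exp_nonneg _)
    (Real.exp_le_one_iff.2 (by have := mul_pos hb0 hτ0; nlinarith)) ?_).trans
    (sub_le_sub_left (mul_le_mul_of_nonneg_right (ReHMC.stdGaussian_norm_le_ge hd)
      (Real.exp_nonneg _)) 1)
  intro v hv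
  have hv : ‖v‖ ≤ 4 * √d := hv
  have hV : ‖v - (η / 2) • gradient f x‖ ≤ 5 * √d := by
    have := norm_sub_le v ((η / 2) • gradient f x)
    rw [norm_smul, Real.norm_of_nonneg (by positivity)] at this
    linarith
  have hH := ReHMC.hamiltonian_leapfrog_le r K f η L ℓ hx.1 hη.le hL.le hdiff hlip
    (by linarith) hV le_rfl le_rfl
  set Q := ((ℓ : ℝ) + 1) * (η * (5 * √d)) *
    (‖gradient f x‖ + L * (((ℓ : ℝ) + 1) * (η * (5 * √d))))
  have hQ0 : 0 ≤ Q := by positivity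
  have hQ : Q ^ 2 ≤ b ^ 2 * (C / √c) := by
    calc Q ^ 2 ≤ (b * (C / √c)) ^ 2 := by gcongr
      _ = b ^ 2 * ((C / √c) * (C / √c)) := by ring
      _ ≤ b ^ 2 * ((C / √c) * 1) := by gcongr
      _ = b ^ 2 * (C / √c) := by ring
  refine le_min (Real.exp_le_one_iff.2 (by have := mul_pos hb0 hτ0; nlinarith)) ?_
  rw [Real.exp_le_exp]
  linarith
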